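/- **Lemma 2 (Probability of $\delta$-margin consistent training).** Consider $K$ agents and a combination matrix $A=[a_{\ell k}]$ with nonnegative entries and columns summing to one, whose graph is strongly connected (there is a path with positive weights between any two agents in both directions) and has at least one self-loop. Let $\pi$ be its Perron eigenvector: $A\pi=\pi$, $\sum_k\pi_k=1$, $\pi_k>0$. Let $\phi:\mathbb R\to[0,\infty)$ be convex, non-increasing, differentiable at $0$ with $\phi'(0)<0$, and $L_\phi$-Lipschitz. Agent $k$ has a feature space $\mathcal H_k$, likelihood models $L_k(\cdot\mid+1)$, $L_k(\cdot\mid-1)$ (probability measures on $\mathcal H_k$), and a class $\mathcal F_k$ of measurable functions $f_k:\mathcal H_k\to\mathbb R$ with $|f_k|\le\beta$, where $\beta>0$ does not depend on $k$; the classes $\mathcal F_k$ and $\{(h,\gamma)\mapsto\phi(\gamma f_k(h)):f_k\in\mathcal F_k\}$ are measurable classes (for every $n$ and $e\in\mathbb R^n$, the supremum over the class of $|\sum_i e_i g(x_i)|$ is a measurable function of $(x_1,\dots,x_n)$). Agent $k$ has $N_k\ge1$ i.i.d. training pairs $(\tilde h_{k,n},\tilde\gamma_{k,n})$, where $\tilde\gamma_{k,n}=\pm1$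 with probability $\tfrac12$ each and $\tilde h_{k,n}\sim L_k(\cdot\mid\gamma)$ given $\tilde\gamma_{k,n}=\gamma$. Put $$\tilde R_k(f_k)=\frac1{N_k}\sum_{n=1}^{N_k}\phi\big(\tilde\gamma_{k,n}f_k(\tilde h_{k,n})\big),\qquad R_k(f_k)=\mathbb E\,\phi\big(\tilde\gamma_{k,n}f_k(\tilde h_{k,n})\big),\qquad \mathsf R^o=\sum_{k=1}^K\pi_k\inf_{f_k\in\mathcal F_k}R_k(f_k),$$ assume $\mathsf R^o<\phi(0)$, and let $\tilde f_k\in\mathcal F_k$ be a minimizer of $\tilde R_k$ over $\mathcal F_k$. For $f=(f_1,\dots,f_K)$ put $$\mu^{\pm}(f)=\sum_k\pi_k\,\mathbb E_{h\sim L_k(\cdot\mid\pm1)}f_k(h),\qquad \tilde\mu(f)=\sum_k\pi_k\frac1{N_k}\sum_{n=1}^{N_k}f_k(\tilde h_{k,n}).$$ Let $\rho=\sum_k\pi_k\rho_k$ be the network Rademacher complexity, where $$\rho_k=\mathbb E\,\sup_{f_k\in\mathcal F_k}\Big|\frac1{N_k}\sum_{n=1}^{N_k}r_nf_k(\tilde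 h_{k,n})\Big|$$ with i.i.d. uniform signs $r_n\in\{\pm1\}$ independent of the training set. Let $N_{\max}=\max_kN_k$ and $\alpha=\sum_k\pi_kN_{\max}/N_k$. Finally let $$g(d)=d-\frac{\phi(d)-\mathsf R^o}{2L_\phi},\qquad d_{\mathsf R}=\inf\{x:\phi(x)=\mathsf R^o\},\qquad \delta_{\max}=\sup\{\delta\ge0:\ g(d)=\delta\text{ has a solution }d<d_{\mathsf R}\}.$$ Let $0\le\delta<\delta_{\max}$. Then $g(d)=\delta$ has a unique solution $d^\star_\delta$, and, with $\mathcal E(\mathsf R^o,\delta)=(d^\star_\delta-\delta)/4$, if $\rho<\mathcal E(\mathsf R^o,\delta)$ then $$\mathbb P\Big(\mu^+(\tilde f)>\tilde\mu(\tilde f)+\delta\ \text{ and }\ \mu^-(\tilde f)<\tilde\mu(\tilde f)-\delta\Big)\ \ge\ 1-2\exp\Big\{-\frac{8N_{\max}}{\alpha^2\beta^2}\big(\mathcal E(\mathsf R^o,\delta)-\rho\big)^2\Big\}.$$ -/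

import Mathlib

open MeasureTheory ProbabilityTheory
open scoped NNReal ENNReal

noncomputable section

namespace SML

/-! Labels are elements of `ℤˣ = {1, -1}`. -/

/-- Combination matrix `A = [a_{ℓk}]` of a strongly connected network: nonnegative weights, columns
summing to one, a path with positive weights between any two agents, and at least one self-loop. -/
structure IsCombinationMatrix {K : ℕ} (A : Matrix (Fin K) (Fin K) ℝ) : Prop where
  nonneg : ∀ l k, 0 ≤ A l k
  col_sum : ∀ k, ∑ l, A l k = 1
  connected : ∀ l k, Relation.ReflTransGen (fun i j => 0 < A i j) l k
  self_loop : ∃ m, 0 < A m m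

/-- Perron eigenvector of the combination matrix. -/
structure IsPerronVector {K : ℕ} (A : Matrix (Fin K) (Fin K) ℝ) (w : Fin K → ℝ) : Prop where
  eigen : A.mulVec w = w
  sum_eq_one : ∑ k, w k = 1
  pos : ∀ k, 0 < w k

/-- Conditions on the loss function `φ : ℝ → ℝ₊` with Lipschitz constant `L`. -/
structure IsLoss (φ : ℝ → ℝ) (L : ℝ≥0) : Prop where
  nonneg : ∀ x, 0 ≤ φ x
  convex : ConvexOn ℝ Set.univ φ
  antitone : Antitone φ
  differentiableAt : DifferentiableAt ℝ φ 0
  deriv_neg : deriv φ 0 < 0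
  lipschitz : LipschitzWith L φ

section Agent

variable {H : Type*} [MeasurableSpace H]

/-- Law of a training pair `(h, γ)`: the label is `±1` with probability `1/2` each, and given the
label `γ` the feature has law `ℓ γ` (the likelihood model). -/
def trainLaw (ℓ : ℤˣ → Measure H) : Measure (H × ℤˣ) :=
  (2⁻¹ : ℝ≥0∞) • (ℓ 1).prod (Measure.dirac 1) + (2⁻¹ : ℝ≥0∞) • (ℓ (-1)).prod (Measure.dirac (-1))

/-- Loss `φ(γ f(h))` of `f` at the labelled example `(h, γ)`. -/
def lossAt (φ : ℝ → ℝ) (f : H → ℝ) (x : H × ℤˣ) : ℝ := φ (((x.2 : ℤ) : ℝ) * f x.1)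

/-- The class of the functions `(h, γ) ↦ φ(γ f(h))`, `f ∈ F`. -/
def lossClass (φ : ℝ → ℝ) (F : Set (H → ℝ)) : Set (H × ℤˣ → ℝ) := lossAt φ '' F

/-- Empirical risk on the training set `x`. -/
def empRisk (φ : ℝ → ℝ) {n : ℕ} (x : Fin n → H × ℤˣ) (f : H → ℝ) : ℝ :=
  (n : ℝ)⁻¹ * ∑ i, lossAt φ f (x i)

/-- Expected risk. -/
def risk (φ : ℝ → ℝ) (ℓ : ℤˣ → Measure H) (f : H → ℝ) : ℝ :=
  ∫ x, lossAt φ f x ∂(trainLaw ℓ)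

/-- Target risk of one agent. -/
def targetRisk (φ : ℝ → ℝ) (ℓ : ℤˣ → Measure H) (F : Set (H → ℝ)) : ℝ :=
  ⨅ f : F, risk φ ℓ f

/-- `f` is a minimizer of the empirical risk over `F`. -/
def IsERM (φ : ℝ → ℝ) (F : Set (H → ℝ)) {n : ℕ} (x : Fin n → H × ℤˣ) (f : H → ℝ) : Prop :=
  f ∈ F ∧ ∀ f' ∈ F, empRisk φ x f ≤ empRisk φ x f'

/-- Empirical training mean. -/
def empMean {n : ℕ} (x : Fin n → H × ℤˣ) (f : H → ℝ) : ℝ :=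
  (n : ℝ)⁻¹ * ∑ i, f (x i).1

/-- Empirical Rademacher complexity of `F` on the sample `h`: the average over the `2 ^ n` equally
likely sign vectors `r`. -/
def empRademacher (F : Set (H → ℝ)) {n : ℕ} (h : Fin n → H) : ℝ :=
  ((2 : ℝ) ^ n)⁻¹ * ∑ r : Fin n → ℤˣ,
    ⨆ f : F, |(n : ℝ)⁻¹ * ∑ i, ((r i : ℤ) : ℝ) * (f : H → ℝ) (h i)|

/-- Expected Rademacher complexity of `F` for `n` i.i.d. training samples. -/
def rademacher (ℓ : ℤˣ → Measure H) (F : Set (H → ℝ)) (n : ℕ) : ℝ :=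
  ∫ x, empRademacher F (fun i => (x i).1) ∂(Measure.pi fun _ : Fin n => trainLaw ℓ)

/-- Measurable class of functions, the standard condition that makes suprema over the class
random variables. -/
structure IsMeasurableClass {E : Type*} [MeasurableSpace E] (G : Set (E → ℝ)) : Prop where
  measurable : ∀ g ∈ G, Measurable g
  measurable_iSup : ∀ (n : ℕ) (e : Fin n → ℝ),
    Measurable fun x : Fin n → E => ⨆ g : G, |∑ i, e i * (g : E → ℝ) (x i)|

end Agent

section Network

variable {K : ℕ} {H : Fin K → Type*} [∀ k, MeasurableSpace (H k)]

/-- Largest training set size. -/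
def Nmax (N : Fin K → ℕ) : ℕ := Finset.univ.sup N

/-- Network imbalance penalty `α`. -/
def imbalance (w : Fin K → ℝ) (N : Fin K → ℕ) : ℝ := ∑ k, w k * ((Nmax N : ℝ) / (N k : ℝ))

/-- Network average `∑ₖ πₖ 𝔼_{γ} fₖ`: `μ⁺(f)` for `γ = 1` and `μ⁻(f)` for `γ = -1`. -/
def netCondMean (w : Fin K → ℝ) (ℓ : ∀ k, ℤˣ → Measure (H k)) (γ : ℤˣ) (f : ∀ k, H k → ℝ) : ℝ :=
  ∑ k, w k * ∫ h, f k h ∂(ℓ k γ)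

/-- Network average of the empirical training means. -/
def netEmpMean (w : Fin K → ℝ) {N : Fin K → ℕ} (x : ∀ k, Fin (N k) → H k × ℤˣ)
    (f : ∀ k, H k → ℝ) : ℝ :=
  ∑ k, w k * empMean (x k) (f k)

/-- Network average of the target risks. -/
def netTargetRisk (w : Fin K → ℝ) (φ : ℝ → ℝ) (ℓ : ∀ k, ℤˣ → Measure (H k))
    (F : ∀ k, Set (H k → ℝ)) : ℝ :=
  ∑ k, w k * targetRisk φ (ℓ k) (F k)

/-- Network Rademacher complexity `ρ`. -/
def netRademacher (w : Fin K → ℝ) (ℓ : ∀ k, ℤˣ → Measure (H k)) (F : ∀ k, Set (H k → ℝ))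
    (N : Fin K → ℕ) : ℝ :=
  ∑ k, w k * rademacher (ℓ k) (F k) (N k)

end Network

/-- `g(d) = d - (φ(d) - R) / (2 L)`. -/
def gFun (φ : ℝ → ℝ) (L R d : ℝ) : ℝ := d - (φ d - R) / (2 * L)

/-- `d_R = inf {x : φ(x) = R}`. -/
def dInf (φ : ℝ → ℝ) (R : ℝ) : ℝ := sInf {x | φ x = R}

/-- `δ_max = sup {δ ≥ 0 : g(d) = δ has a solution d < d_R}`. -/
def deltaMax (φ : ℝ → ℝ) (L R : ℝ) : ℝ :=
  sSup {δ | 0 ≤ δ ∧ ∃ d, gFun φ L R d = δ ∧ d < dInf φ R}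

end SML

end

namespace SML

section McDiarmid

variable {E : Type*} [MeasurableSpace E] {μ : Measure E} [IsProbabilityMeasure μ]

/-- **Hoeffding's lemma** for a function whose oscillation is at most `c`. -/
lemma hasSubgaussianMGF_of_osc_le {T : E → ℝ} (hT : Measurable T) {c : ℝ≥0}
    (hc : ∀ x y, T x - T y ≤ c) :
    HasSubgaussianMGF (fun x => T x - ∫ x, T x ∂μ) ((c / 2) ^ 2) μ := by
  have : Nonempty E := nonempty_of_isProbabilityMeasure μ
  have hbdd : BddAbove (Set.range T) := by
    refine ⟨T (Classical.arbitrary E) + c, ?_⟩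
    rintro _ ⟨x, rfl⟩
    linarith [hc x (Classical.arbitrary E)]
  have hub : ∀ x, T x ≤ ⨆ x, T x := fun x => le_ciSup hbdd x
  have hlb : ∀ x, (⨆ x, T x) - c ≤ T x := fun x => by
    have : (⨆ x, T x) ≤ T x + c := ciSup_le fun y => by linarith [hc y x]
    linarith
  have h := hasSubgaussianMGF_of_mem_Icc (μ := μ) hT.aemeasurable
    (ae_of_all _ fun x => ⟨hlb x, hub x⟩)
  have hc' : ‖(⨆ x, T x) - ((⨆ x, T x) - (c : ℝ))‖₊ = c := by
    rw [sub_sub_cancel]; simp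
  rwa [hc'] at h

/-- **McDiarmid's inequality** in the form of a sub-Gaussian bound: a function of `n` i.i.d.
variables that changes by at most `c` when one of them changes. -/
lemma hasSubgaussianMGF_pi_of_bounded_differences {n : ℕ} {T : (Fin n → E) → ℝ}
    (hT : Measurable T) {c : ℝ≥0} {B : ℝ} (hB : ∀ x, |T x| ≤ B)
    (hc : ∀ x i y, T (Function.update x i y) - T x ≤ c) :
    HasSubgaussianMGF (fun x => T x - ∫ x, T x ∂(Measure.pi fun _ => μ)) (n * (c / 2) ^ 2)
      (Measure.pi fun _ => μ) := by
  induction n with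
  | zero =>
    have h0 : ∀ x, T x = T default := fun x => by rw [Subsingleton.elim x default]
    have : (fun x => T x - ∫ x, T x ∂(Measure.pi fun _ : Fin 0 => μ)) = fun _ => (0 : ℝ) := by
      funext x
      simp_rw [h0]
      simp
    rw [this]
    simp
  | succ n ih =>
    set e := (MeasurableEquiv.piFinSuccAbove (fun _ : Fin (n + 1) => E) 0).symm with he
    have hpres : MeasurePreserving e (μ.prod (Measure.pi fun _ : Fin n => μ))
        (Measure.pi fun _ : Fin (n + 1) => μ) :=
      (measurePreserving_piFinSuccAbove (fun _ : Fin (n + 1) => μ) 0).symm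
    have he_apply : ∀ a y, e (a, y) = Fin.cons a y := fun a y => by
      simp [he, MeasurableEquiv.piFinSuccAbove, Fin.insertNthEquiv]
    set U : E × (Fin n → E) → ℝ := fun z => T (e z) with hU
    have hUm : Measurable U := hT.comp e.measurable
    have hUB : ∀ z, |U z| ≤ B := fun z => hB _
    have hUint : ∀ y, Integrable (fun a => U (a, y)) μ := fun y =>
      Integrable.of_bound (hUm.comp measurable_prodMk_right).aestronglyMeasurable B
        (ae_of_all _ fun a => by simpa using hUB (a, y))
    set T' : (Fin n → E) → ℝ := fun y => ∫ a, U (a, y) ∂μ with hT'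
    have hT'm : Measurable T' := by
      have : StronglyMeasurable (fun y => ∫ a, U (a, y) ∂μ) :=
        hUm.stronglyMeasurable.integral_prod_left'
      exact this.measurable
    have hT'B : ∀ y, |T' y| ≤ B := fun y => by
      have := norm_integral_le_of_norm_le_const (μ := μ)
        (ae_of_all _ fun a => by simpa using hUB (a, y) : ∀ᵐ a ∂μ, ‖U (a, y)‖ ≤ B)
      simpa using this
    have hT'c : ∀ x i y, T' (Function.update x i y) - T' x ≤ c := fun x i y => by
      rw [hT']
      simp only
      rw [← integral_sub (hUint _) (hUint _)]
      refine (integral_mono ((hUint _).sub (hUint _)) (integrable_const (c : ℝ)) fun a => ?_).trans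
        (by simp)
      change T (e (a, Function.update x i y)) - T (e (a, x)) ≤ c
      rw [he_apply, he_apply, Fin.cons_update]
      exact hc _ _ _
    have hIH := ih hT'm hT'B hT'c
    have hmean : ∫ x, T x ∂(Measure.pi fun _ : Fin (n + 1) => μ)
        = ∫ y, T' y ∂(Measure.pi fun _ : Fin n => μ) := by
      rw [← hpres.integral_comp' (f := e)]
      exact integral_prod_symm _ (Integrable.of_bound hUm.aestronglyMeasurable B
        (ae_of_all _ fun z => by simpa using hUB z))
    set m := ∫ y, T' y ∂(Measure.pi fun _ : Fin n => μ) with hm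
    rw [hmean]
    have hexpint : ∀ (t : ℝ) (z : E × (Fin n → E)), ‖Real.exp (t * (U z - m))‖
        ≤ Real.exp (|t| * (B + |m|)) := fun t z => by
      rw [Real.norm_eq_abs, Real.abs_exp, Real.exp_le_exp]
      calc t * (U z - m) ≤ |t * (U z - m)| := le_abs_self _
        _ = |t| * |U z - m| := abs_mul _ _
        _ ≤ |t| * (B + |m|) := by
          gcongr
          exact (abs_sub _ _).trans (by gcongr; exact hUB z)
    have hexpm : ∀ t : ℝ, Measurable fun z => Real.exp (t * (U z - m)) := fun t => by fun_prop
    have hexpI : ∀ t : ℝ, Integrable (fun z => Real.exp (t * (U z - m)))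
        (μ.prod (Measure.pi fun _ : Fin n => μ)) := fun t =>
      Integrable.of_bound (hexpm t).aestronglyMeasurable _ (ae_of_all _ (hexpint t))
    constructor
    · intro t
      rw [← hpres.integrable_comp_emb e.measurableEmbedding]
      exact hexpI t
    · intro t
      have hstep : ∀ y, ∫ a, Real.exp (t * (U (a, y) - m)) ∂μ
          ≤ Real.exp (((c / 2 : ℝ≥0) ^ 2 : ℝ≥0) * t ^ 2 / 2) * Real.exp (t * (T' y - m)) := fun y => by
        have hsub := (hasSubgaussianMGF_of_osc_le (μ := μ) (T := fun a => U (a, y)) (c := c)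
          (hUm.comp measurable_prodMk_right) fun a b => by
            have := hc (Fin.cons b y) 0 a
            rw [Fin.update_cons_zero] at this
            simpa only [hU, he_apply] using this).mgf_le t
        have : ∀ a, Real.exp (t * (U (a, y) - m))
            = Real.exp (t * (U (a, y) - T' y)) * Real.exp (t * (T' y - m)) := fun a => by
          rw [← Real.exp_add]; ring_nf
        simp_rw [this]
        rw [integral_mul_const]
        gcongr
        exact hsub
      calc mgf (fun x => T x - m) (Measure.pi fun _ : Fin (n + 1) => μ) t
          = ∫ z, Real.exp (t * (U z - m)) ∂(μ.prod (Measure.pi fun _ : Fin n => μ)) := by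
            rw [mgf, ← hpres.integral_comp' (f := e)]
        _ = ∫ y, ∫ a, Real.exp (t * (U (a, y) - m)) ∂μ ∂(Measure.pi fun _ : Fin n => μ) :=
            integral_prod_symm _ (hexpI t)
        _ ≤ ∫ y, Real.exp (((c / 2 : ℝ≥0) ^ 2 : ℝ≥0) * t ^ 2 / 2) * Real.exp (t * (T' y - m))
              ∂(Measure.pi fun _ : Fin n => μ) :=
            integral_mono (hexpI t).integral_prod_right
              ((hIH.integrable_exp_mul t).const_mul _) hstep
        _ = Real.exp (((c / 2 : ℝ≥0) ^ 2 : ℝ≥0) * t ^ 2 / 2)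
              * mgf (fun y => T' y - m) (Measure.pi fun _ : Fin n => μ) t := by
            rw [integral_const_mul, mgf]
        _ ≤ Real.exp (((c / 2 : ℝ≥0) ^ 2 : ℝ≥0) * t ^ 2 / 2)
              * Real.exp ((n * (c / 2) ^ 2 : ℝ≥0) * t ^ 2 / 2) := by
            gcongr
            exact hIH.mgf_le t
        _ = _ := by
            rw [← Real.exp_add]
            push_cast
            ring_nf

end McDiarmid

section Contraction

lemma ciSup_add_ciSup_contraction {J : Type*} [Nonempty J] {b s u : J → ℝ} {C : ℝ}
    (hb : ∀ j, |b j| ≤ C) (hu : ∀ j, |u j| ≤ C)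
    (h : ∀ j j', |s j - s j'| ≤ |u j - u j'|) :
    (⨆ j, (b j + s j)) + (⨆ j, (b j - s j)) ≤ (⨆ j, (b j + u j)) + ⨆ j, (b j - u j) := by
  have h1 : BddAbove (Set.range fun j => b j + u j) := by
    refine ⟨2 * C, ?_⟩
    rintro _ ⟨j, rfl⟩
    have := abs_le.1 (hb j); have := abs_le.1 (hu j); simp only; linarith
  have h2 : BddAbove (Set.range fun j => b j - u j) := by
    refine ⟨2 * C, ?_⟩
    rintro _ ⟨j, rfl⟩
    have := abs_le.1 (hb j); have := abs_le.1 (hu j); simp only; linarith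
  refine ciSup_add_ciSup_le fun j j' => ?_
  have hs := (le_abs_self _).trans (h j j')
  have a1 := le_ciSup h1 j
  have a2 := le_ciSup h2 j'
  have a3 := le_ciSup h1 j'
  have a4 := le_ciSup h2 j
  rcases abs_cases (u j - u j') with ⟨h, -⟩ | ⟨h, -⟩ <;> linarith

lemma sum_units_fin_succ {n : ℕ} (f : (Fin (n + 1) → ℤˣ) → ℝ) :
    ∑ r, f r = ∑ r : Fin n → ℤˣ, (f (Fin.cons 1 r) + f (Fin.cons (-1) r)) := by
  rw [← (Fin.consEquiv (fun _ : Fin (n + 1) => ℤˣ)).sum_comp, Fintype.sum_prod_type_right]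
  refine Finset.sum_congr rfl fun r _ => ?_
  have : (Finset.univ : Finset ℤˣ) = {1, -1} := by decide
  rw [this, Finset.sum_pair (by decide)]
  rfl

/-- **Contraction principle**, one-sided form. -/
lemma sum_signs_ciSup_contraction {J : Type*} [Nonempty J] {n : ℕ} (a : J → ℝ)
    (s u : J → Fin n → ℝ) {C : ℝ} (ha : ∀ j, |a j| ≤ C) (hs : ∀ j i, |s j i| ≤ C)
    (hu : ∀ j i, |u j i| ≤ C)
    (h : ∀ j j' i, |s j i - s j' i| ≤ |u j i - u j' i|) :
    ∑ r : Fin n → ℤˣ, ⨆ j, (a j + ∑ i, ((r i : ℤ) : ℝ) * s j i)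
      ≤ ∑ r : Fin n → ℤˣ, ⨆ j, (a j + ∑ i, ((r i : ℤ) : ℝ) * u j i) := by
  induction n generalizing a C with
  | zero => simp
  | succ n ih =>
    have hC : 0 ≤ C := (abs_nonneg _).trans (ha (Classical.arbitrary J))
    rw [sum_units_fin_succ, sum_units_fin_succ]
    simp only [Fin.sum_univ_succ, Fin.cons_zero, Fin.cons_succ, Units.val_one, Int.cast_one,
      one_mul, Units.val_neg, Int.cast_neg, neg_mul]
    rw [Finset.sum_add_distrib]
    have key : ∀ v : J → ℝ, (∀ j, |v j| ≤ C) →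
        ∑ r : Fin n → ℤˣ, ⨆ j, (a j + (v j + ∑ i : Fin n, ((r i : ℤ) : ℝ) * s j i.succ))
        ≤ ∑ r : Fin n → ℤˣ, ⨆ j, (a j + (v j + ∑ i : Fin n, ((r i : ℤ) : ℝ) * u j i.succ)) := by
      intro v hv
      simp_rw [← add_assoc]
      refine ih (fun j => a j + v j) (fun j i => s j i.succ) (fun j i => u j i.succ) (C := C + C)
        (fun j => (abs_add_le _ _).trans (add_le_add (ha j) (hv j)))
        (fun j i => (hs _ _).trans (by linarith)) (fun j i => (hu _ _).trans (by linarith))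
        fun j j' i => h j j' i.succ
    refine (add_le_add (key (fun j => s j 0) fun j => hs j 0)
      (key (fun j => -s j 0) fun j => by rw [abs_neg]; exact hs j 0)).trans ?_
    rw [← Finset.sum_add_distrib]
    refine Finset.sum_le_sum fun r _ => ?_
    have := ciSup_add_ciSup_contraction
      (b := fun j => a j + ∑ i : Fin n, ((r i : ℤ) : ℝ) * u j i.succ)
      (s := fun j => s j 0) (u := fun j => u j 0) (C := C + n * C)
      (fun j => (abs_add_le _ _).trans (add_le_add (ha j)
        ((Finset.abs_sum_le_sum_abs _ _).trans ((Finset.sum_le_sum (g := fun _ => C) fun i _ => ?_).trans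
          (by simp)))))
      (fun j => (hu j 0).trans (by nlinarith [Nat.cast_nonneg (α := ℝ) n]))
      (fun j j' => h j j' 0)
    · refine le_of_eq_of_le ?_ (this.trans_eq ?_)
      all_goals
        exact congrArg₂ (· + ·) (iSup_congr fun j => by ring) (iSup_congr fun j => by ring)
    · rw [abs_mul]
      rcases Int.units_eq_one_or (r i) with h | h <;> simp [h, hu]

/-- **Contraction principle** for suprema of absolute values. -/
lemma sum_signs_ciSup_abs_contraction {J : Type*} [Nonempty J] {n : ℕ}
    (s u : J → Fin n → ℝ) {C : ℝ} (hs : ∀ j i, |s j i| ≤ C) (hu : ∀ j i, |u j i| ≤ C)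
    (h : ∀ j j' i, |s j i - s j' i| ≤ |u j i - u j' i|) (h0 : ∀ j i, |s j i| ≤ |u j i|) :
    ∑ r : Fin n → ℤˣ, ⨆ j, |∑ i, ((r i : ℤ) : ℝ) * s j i|
      ≤ 2 * ∑ r : Fin n → ℤˣ, ⨆ j, |∑ i, ((r i : ℤ) : ℝ) * u j i| := by
  have hsum : ∀ (v : J → Fin n → ℝ), (∀ j i, |v j i| ≤ C) → ∀ (r : Fin n → ℤˣ) j,
      |∑ i, ((r i : ℤ) : ℝ) * v j i| ≤ n * C := fun v hv r j => by
    refine (Finset.abs_sum_le_sum_abs _ _).trans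
      ((Finset.sum_le_sum (g := fun _ => C) fun i _ => ?_).trans (by simp))
    rw [abs_mul]
    rcases Int.units_eq_one_or (r i) with h | h <;> simp [h, hv]
  let ext : (J → Fin n → ℝ) → Option J → Fin n → ℝ := fun v o => o.elim 0 v
  have hC : ∀ i : Fin n, 0 ≤ C := fun i => (abs_nonneg _).trans (hs (Classical.arbitrary J) i)
  have hext : ∀ v, (∀ j i, |v j i| ≤ C) → ∀ o i, |ext v o i| ≤ C := by
    rintro v hv (_ | j) i
    · simpa [ext] using hC i
    · exact hv j i
  have hbdd : ∀ v, (∀ j i, |v j i| ≤ C) → ∀ r : Fin n → ℤˣ,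
      BddAbove (Set.range fun o => ∑ i, ((r i : ℤ) : ℝ) * ext v o i) := by
    rintro v hv r
    refine ⟨n * C, ?_⟩
    rintro _ ⟨_ | j, rfl⟩
    · have : 0 ≤ n * C := by
        cases n with
        | zero => simp
        | succ n => exact mul_nonneg (Nat.cast_nonneg _) (hC 0)
      simpa [ext] using this
    · exact (le_abs_self _).trans (hsum v hv r j)
  have hpos : ∀ v, (∀ j i, |v j i| ≤ C) → ∀ r : Fin n → ℤˣ,
      0 ≤ ⨆ o, ∑ i, ((r i : ℤ) : ℝ) * ext v o i := fun v hv r => by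
    have := le_ciSup (hbdd v hv r) none
    simpa [ext] using this
  have hone := sum_signs_ciSup_contraction (fun _ : Option J => (0 : ℝ)) (ext s) (ext u) (C := |C|)
    (by simp) (fun o i => (hext s hs o i).trans (le_abs_self _))
    (fun o i => (hext u hu o i).trans (le_abs_self _)) (by
      rintro (_ | j) (_ | j') i
      · simp [ext]
      · simpa [ext] using h0 j' i
      · simpa [ext] using h0 j i
      · exact h j j' i)
  simp only [zero_add] at hone
  have hneg : ∑ r : Fin n → ℤˣ, ⨆ o, ∑ i, (((-r) i : ℤˣ) : ℤ) * ext s o i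
      = ∑ r : Fin n → ℤˣ, ⨆ o, ∑ i, ((r i : ℤ) : ℝ) * ext s o i :=
    Equiv.sum_comp (Equiv.neg (Fin n → ℤˣ)) fun r : Fin n → ℤˣ => ⨆ o, ∑ i, ((r i : ℤ) : ℝ) * ext s o i
  calc ∑ r : Fin n → ℤˣ, ⨆ j, |∑ i, ((r i : ℤ) : ℝ) * s j i|
      ≤ ∑ r : Fin n → ℤˣ, ((⨆ o, ∑ i, ((r i : ℤ) : ℝ) * ext s o i)
          + ⨆ o, ∑ i, (((-r) i : ℤˣ) : ℤ) * ext s o i) := by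
        refine Finset.sum_le_sum fun r _ => ciSup_le fun j => ?_
        have h1 := le_ciSup (hbdd s hs r) (some j)
        have h2 := le_ciSup (hbdd s hs (-r)) (some j)
        have h3 := hpos s hs r
        have h4 := hpos s hs (-r)
        have h5 : ∑ i, (((-r) i : ℤˣ) : ℤ) * ext s (some j) i
            = -∑ i, ((r i : ℤ) : ℝ) * ext s (some j) i := by simp
        rw [h5] at h2
        change |∑ i, ((r i : ℤ) : ℝ) * ext s (some j) i| ≤ _
        exact abs_le'.2 ⟨by linarith, by linarith⟩
    _ = 2 * ∑ r : Fin n → ℤˣ, ⨆ o, ∑ i, ((r i : ℤ) : ℝ) * ext s o i := by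
        rw [Finset.sum_add_distrib, hneg]; ring
    _ ≤ 2 * ∑ r : Fin n → ℤˣ, ⨆ o, ∑ i, ((r i : ℤ) : ℝ) * ext u o i := by gcongr
    _ ≤ _ := by
        gcongr with r
        have hb : BddAbove (Set.range fun j => |∑ i, ((r i : ℤ) : ℝ) * u j i|) := by
          refine ⟨n * C, ?_⟩
          rintro _ ⟨j, rfl⟩
          exact hsum u hu r j
        refine ciSup_le ?_
        rintro (_ | j)
        · simpa [ext] using Real.iSup_nonneg fun j => abs_nonneg (∑ i, ((r i : ℤ) : ℝ) * u j i)
        · exact (le_abs_self _).trans (le_ciSup hb j)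

end Contraction

section Symmetrization

lemma abs_inv_mul_sum_le {n : ℕ} {v : Fin n → ℝ} {c : ℝ≥0} (hv : ∀ i, |v i| ≤ c) :
    |(n : ℝ)⁻¹ * ∑ i, v i| ≤ c := by
  rcases Nat.eq_zero_or_pos n with rfl | hn
  · simp
  · have hn' : (0 : ℝ) < n := Nat.cast_pos.2 hn
    rw [abs_mul, abs_of_pos (inv_pos.2 hn'), inv_mul_le_iff₀ hn']
    refine (Finset.abs_sum_le_sum_abs _ _).trans
      ((Finset.sum_le_sum (g := fun _ => (c : ℝ)) fun i _ => hv i).trans (by simp))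

lemma abs_units_mul (r : ℤˣ) (a : ℝ) : |((r : ℤ) : ℝ) * a| = |a| := by
  rcases Int.units_eq_one_or r with h | h <;> simp [h]

variable {E : Type*}

/-- Largest signed deviation, over the class `G`, between the empirical means of two samples. -/
noncomputable def pairDev (G : Set (E → ℝ)) {n : ℕ} (r : Fin n → ℤˣ) (x x' : Fin n → E) : ℝ :=
  ⨆ g : G, |(n : ℝ)⁻¹ * ∑ i, ((r i : ℤ) : ℝ) * ((g : E → ℝ) (x i) - (g : E → ℝ) (x' i))|

variable {G : Set (E → ℝ)} {n : ℕ} {c : ℝ≥0}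

lemma abs_signed_mean_le (hosc : ∀ g ∈ G, ∀ x y, |g x - g y| ≤ c) (r : Fin n → ℤˣ)
    (x x' : Fin n → E) (g : G) :
    |(n : ℝ)⁻¹ * ∑ i, ((r i : ℤ) : ℝ) * ((g : E → ℝ) (x i) - (g : E → ℝ) (x' i))| ≤ c :=
  abs_inv_mul_sum_le fun i => by rw [abs_units_mul]; exact hosc g g.2 _ _

lemma bddAbove_pairDev (hosc : ∀ g ∈ G, ∀ x y, |g x - g y| ≤ c) (r : Fin n → ℤˣ)
    (x x' : Fin n → E) :
    BddAbove (Set.range fun g : G =>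
      |(n : ℝ)⁻¹ * ∑ i, ((r i : ℤ) : ℝ) * ((g : E → ℝ) (x i) - (g : E → ℝ) (x' i))|) := by
  refine ⟨c, ?_⟩
  rintro _ ⟨g, rfl⟩
  exact abs_signed_mean_le hosc r x x' g

lemma pairDev_nonneg (r : Fin n → ℤˣ) (x x' : Fin n → E) : 0 ≤ pairDev G r x x' :=
  Real.iSup_nonneg fun _ => abs_nonneg _

lemma pairDev_le (hosc : ∀ g ∈ G, ∀ x y, |g x - g y| ≤ c) (r : Fin n → ℤˣ)
    (x x' : Fin n → E) : pairDev G r x x' ≤ c :=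
  Real.iSup_le (fun g => abs_signed_mean_le hosc r x x' g) c.2

variable [MeasurableSpace E] {μ : Measure E}

/-- Expected largest deviation over `G` between the empirical mean on `x` and the empirical mean
on an independent sample. -/
noncomputable def ghostDev (G : Set (E → ℝ)) (μ : Measure E) {n : ℕ} (x : Fin n → E) : ℝ :=
  ∫ x', pairDev G 1 x x' ∂(Measure.pi fun _ => μ)

lemma measurable_pairDev (hG : IsMeasurableClass G) (r : Fin n → ℤˣ) :
    Measurable fun z : (Fin n → E) × (Fin n → E) => pairDev G r z.1 z.2 := by
  have happ : Measurable fun z : (Fin n → E) × (Fin n → E) => Fin.append z.1 z.2 := by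
    refine measurable_pi_iff.2 fun i => ?_
    refine Fin.addCases (fun j => ?_) (fun j => ?_) i
    · simp only [Fin.append_left]; fun_prop
    · simp only [Fin.append_right]; fun_prop
  have := (hG.measurable_iSup (n + n) (Fin.append (fun i => (n : ℝ)⁻¹ * ((r i : ℤ) : ℝ))
    (fun i => -((n : ℝ)⁻¹ * ((r i : ℤ) : ℝ))))).comp happ
  convert this using 1
  funext z
  refine iSup_congr fun g => ?_
  rw [Fin.sum_univ_add]
  simp only [Fin.append_left, Fin.append_right]
  rw [← Finset.sum_add_distrib, Finset.mul_sum]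
  congr 1
  exact Finset.sum_congr rfl fun i _ => by ring

lemma ghostDev_nonneg (x : Fin n → E) : 0 ≤ ghostDev G μ x :=
  integral_nonneg fun _ => pairDev_nonneg _ _ _

variable [IsProbabilityMeasure μ]

lemma integrable_pairDev (hG : IsMeasurableClass G) (hosc : ∀ g ∈ G, ∀ x y, |g x - g y| ≤ c)
    (r : Fin n → ℤˣ) (x : Fin n → E) :
    Integrable (pairDev G r x) (Measure.pi fun _ => μ) :=
  Integrable.of_bound ((measurable_pairDev hG r).comp measurable_prodMk_left).aestronglyMeasurable c
    (ae_of_all _ fun x' => by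
      rw [Real.norm_eq_abs, abs_of_nonneg (pairDev_nonneg r x x')]; exact pairDev_le hosc r x x')

lemma integrable_pairDev_prod (hG : IsMeasurableClass G)
    (hosc : ∀ g ∈ G, ∀ x y, |g x - g y| ≤ c) (r : Fin n → ℤˣ) :
    Integrable (fun z : (Fin n → E) × (Fin n → E) => pairDev G r z.1 z.2)
      ((Measure.pi fun _ => μ).prod (Measure.pi fun _ => μ)) :=
  Integrable.of_bound (measurable_pairDev hG r).aestronglyMeasurable c
    (ae_of_all _ fun z => by
      rw [Real.norm_eq_abs, abs_of_nonneg (pairDev_nonneg r _ _)]; exact pairDev_le hosc r _ _)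

lemma measurable_ghostDev (hG : IsMeasurableClass G) :
    Measurable fun x : Fin n → E => ghostDev G μ x :=
  (measurable_pairDev hG 1).stronglyMeasurable.integral_prod_right'.measurable

lemma ghostDev_le (hG : IsMeasurableClass G) (hosc : ∀ g ∈ G, ∀ x y, |g x - g y| ≤ c)
    (x : Fin n → E) : ghostDev G μ x ≤ c :=
  (integral_mono (integrable_pairDev hG hosc 1 x) (integrable_const _)
    fun x' => pairDev_le hosc 1 x x').trans (by simp)

lemma ghostDev_update_sub_le (hG : IsMeasurableClass G)
    (hosc : ∀ g ∈ G, ∀ x y, |g x - g y| ≤ c) (x : Fin n → E) (i : Fin n) (y : E) :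
    ghostDev G μ (Function.update x i y) - ghostDev G μ x ≤ (c / n : ℝ≥0) := by
  rw [ghostDev, ghostDev, ← integral_sub (integrable_pairDev hG hosc _ _)
    (integrable_pairDev hG hosc _ _)]
  refine (integral_mono ((integrable_pairDev hG hosc _ _).sub (integrable_pairDev hG hosc _ _))
    (integrable_const ((c / n : ℝ≥0) : ℝ)) fun x' => ?_).trans (by simp)
  change pairDev G 1 (Function.update x i y) x' - pairDev G 1 x x' ≤ (c / n : ℝ≥0)
  rw [sub_le_iff_le_add']
  refine Real.iSup_le (fun g => ?_) (add_nonneg (pairDev_nonneg _ _ _) (NNReal.coe_nonneg _))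
  have hsplit : (n : ℝ)⁻¹ * ∑ j, (((1 : Fin n → ℤˣ) j : ℤ) : ℝ)
        * ((g : E → ℝ) (Function.update x i y j) - (g : E → ℝ) (x' j))
      = (n : ℝ)⁻¹ * ∑ j, (((1 : Fin n → ℤˣ) j : ℤ) : ℝ) * ((g : E → ℝ) (x j) - (g : E → ℝ) (x' j))
        + (n : ℝ)⁻¹ * ((g : E → ℝ) y - (g : E → ℝ) (x i)) := by
    rw [← mul_add]
    congr 1
    have : ∀ j, (g : E → ℝ) (Function.update x i y j)
        = (g : E → ℝ) (x j) + if j = i then (g : E → ℝ) y - (g : E → ℝ) (x i) else 0 := fun j => by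
      by_cases h : j = i
      · subst h; simp
      · simp [h]
    simp_rw [this]
    simp [Finset.sum_add_distrib, Finset.sum_sub_distrib]
    ring
  rw [hsplit]
  refine (abs_add_le _ _).trans (add_le_add (le_ciSup (bddAbove_pairDev hosc 1 x x') g) ?_)
  rw [abs_mul, abs_of_nonneg (by positivity), NNReal.coe_div, NNReal.coe_natCast, div_eq_inv_mul]
  gcongr
  exact hosc g g.2 _ _

lemma integrable_of_osc_le (hG : IsMeasurableClass G)
    (hosc : ∀ g ∈ G, ∀ x y, |g x - g y| ≤ c) {g : E → ℝ} (hg : g ∈ G) : Integrable g μ := by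
  have : Nonempty E := nonempty_of_isProbabilityMeasure μ
  refine Integrable.of_bound (hG.measurable g hg).aestronglyMeasurable
    (|g (Classical.arbitrary E)| + c) (ae_of_all _ fun x => ?_)
  have h1 := hosc g hg x (Classical.arbitrary E)
  have h2 := abs_sub_abs_le_abs_sub (g x) (g (Classical.arbitrary E))
  rw [Real.norm_eq_abs]
  linarith

/-- The deviation of the empirical mean from the mean is at most `ghostDev`. -/
lemma abs_mean_sub_integral_le_ghostDev (hn : 0 < n) (hG : IsMeasurableClass G)
    (hosc : ∀ g ∈ G, ∀ x y, |g x - g y| ≤ c) {g : E → ℝ} (hg : g ∈ G) (x : Fin n → E) :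
    |(n : ℝ)⁻¹ * ∑ i, g (x i) - ∫ y, g y ∂μ| ≤ ghostDev G μ x := by
  have hn' : (n : ℝ) ≠ 0 := Nat.cast_ne_zero.2 hn.ne'
  have hgi : Integrable g μ := integrable_of_osc_le hG hosc hg
  have hgi' : ∀ i : Fin n, Integrable (fun x' : Fin n → E => g (x' i)) (Measure.pi fun _ => μ) :=
    fun i => (measurePreserving_eval (fun _ : Fin n => μ) i).integrable_comp_of_integrable hgi
  have hmean : ∀ i : Fin n, ∫ x' : Fin n → E, g (x' i) ∂(Measure.pi fun _ => μ) = ∫ y, g y ∂μ :=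
    fun i => integral_comp_eval (μ := fun _ : Fin n => μ) hgi.aestronglyMeasurable
  have hI : ∀ i : Fin n, Integrable (fun x' : Fin n → E =>
      (((1 : Fin n → ℤˣ) i : ℤ) : ℝ) * (g (x i) - g (x' i))) (Measure.pi fun _ => μ) := fun i =>
    ((integrable_const _).sub (hgi' i)).const_mul _
  have heq : (n : ℝ)⁻¹ * ∑ i, g (x i) - ∫ y, g y ∂μ
      = ∫ x' : Fin n → E, (n : ℝ)⁻¹ * ∑ i, (((1 : Fin n → ℤˣ) i : ℤ) : ℝ) * (g (x i) - g (x' i))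
        ∂(Measure.pi fun _ => μ) := by
    rw [integral_const_mul, integral_finsetSum _ fun i _ => hI i]
    have : ∀ i, ∫ x' : Fin n → E, (((1 : Fin n → ℤˣ) i : ℤ) : ℝ) * (g (x i) - g (x' i))
        ∂(Measure.pi fun _ => μ) = g (x i) - ∫ y, g y ∂μ := fun i => by
      rw [integral_const_mul, integral_sub (integrable_const _) (hgi' i), hmean]
      simp
    simp_rw [this]
    rw [Finset.sum_sub_distrib]
    simp only [Finset.sum_const, Finset.card_univ, Fintype.card_fin, nsmul_eq_mul]
    field_simp
  rw [heq]
  refine (abs_integral_le_integral_abs).trans ?_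
  refine integral_mono ((integrable_finsetSum _ fun i _ => hI i).const_mul _).abs
    (integrable_pairDev hG hosc 1 x) fun x' => ?_
  exact le_ciSup (bddAbove_pairDev hosc 1 x x') ⟨g, hg⟩

/-- Exchangeability of the two samples: the expected signed deviation does not depend on the
signs. -/
lemma integral_pairDev_eq (r : Fin n → ℤˣ) :
    ∫ z, pairDev G r z.1 z.2 ∂((Measure.pi fun _ : Fin n => μ).prod (Measure.pi fun _ => μ))
      = ∫ z, pairDev G 1 z.1 z.2
          ∂((Measure.pi fun _ : Fin n => μ).prod (Measure.pi fun _ => μ)) := by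
  let e := MeasurableEquiv.arrowProdEquivProdArrow E E (Fin n)
  have he : MeasurePreserving e (.pi fun _ => μ.prod μ)
      ((Measure.pi fun _ => μ).prod (Measure.pi fun _ => μ)) :=
    measurePreserving_arrowProdEquivProdArrow E E (Fin n) (fun _ => μ) (fun _ => μ)
  let s : Fin n → E × E ≃ᵐ E × E := fun i =>
    if r i = 1 then MeasurableEquiv.refl _ else MeasurableEquiv.prodComm
  have hs : ∀ i, MeasurePreserving (s i) (μ.prod μ) (μ.prod μ) := fun i => by
    by_cases h : r i = 1
    · simp only [s, h, if_true]; exact MeasurePreserving.id _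
    · simp only [s, h, if_false]; exact Measure.measurePreserving_swap
  let S : (Fin n → E × E) ≃ᵐ (Fin n → E × E) := MeasurableEquiv.piCongrRight s
  have hS : MeasurePreserving S (.pi fun _ => μ.prod μ) (.pi fun _ => μ.prod μ) :=
    measurePreserving_pi _ _ hs
  rw [← he.integral_comp' (f := e), ← he.integral_comp' (f := e), ← hS.integral_comp' (f := S)]
  refine integral_congr_ae (ae_of_all _ fun z => iSup_congr fun g => ?_)
  congr 2
  refine Finset.sum_congr rfl fun i _ => ?_
  change ((r i : ℤ) : ℝ) * ((g : E → ℝ) ((s i) (z i)).1 - (g : E → ℝ) ((s i) (z i)).2)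
    = (((1 : ℤˣ) : ℤ) : ℝ) * ((g : E → ℝ) (z i).1 - (g : E → ℝ) (z i).2)
  rcases Int.units_eq_one_or (r i) with h | h
  · simp [s, h]
  · have h' : ¬ ((-1 : ℤˣ) = 1) := by decide
    have hswap : s i (z i) = (z i).swap := by simp only [s, h, h', if_false]; rfl
    rw [hswap, h]
    simp

/-- **Symmetrization**: the expected deviation is at most twice the Rademacher complexity of the
class, centred at `a`. -/
lemma integral_ghostDev_le (hG : IsMeasurableClass G)
    (hosc : ∀ g ∈ G, ∀ x y, |g x - g y| ≤ c) {a : ℝ} {B : ℝ≥0} (hB : ∀ g ∈ G, ∀ x, |g x - a| ≤ B)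
    {U : (Fin n → E) → ℝ} (hUi : Integrable U (Measure.pi fun _ => μ))
    (hU : ∀ x, ((2 : ℝ) ^ n)⁻¹ * ∑ r : Fin n → ℤˣ,
      ⨆ g : G, |(n : ℝ)⁻¹ * ∑ i, ((r i : ℤ) : ℝ) * ((g : E → ℝ) (x i) - a)| ≤ U x) :
    ∫ x, ghostDev G μ x ∂(Measure.pi fun _ : Fin n => μ)
      ≤ 2 * ∫ x, U x ∂(Measure.pi fun _ => μ) := by
  set ν := Measure.pi fun _ : Fin n => μ with hν
  have hpair : ∀ (r : Fin n → ℤˣ) x x', pairDev G r x x'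
      ≤ (⨆ g : G, |(n : ℝ)⁻¹ * ∑ i, ((r i : ℤ) : ℝ) * ((g : E → ℝ) (x i) - a)|)
        + ⨆ g : G, |(n : ℝ)⁻¹ * ∑ i, ((r i : ℤ) : ℝ) * ((g : E → ℝ) (x' i) - a)| := by
    intro r x x'
    have hbdd : ∀ x : Fin n → E, BddAbove (Set.range fun g : G =>
        |(n : ℝ)⁻¹ * ∑ i, ((r i : ℤ) : ℝ) * ((g : E → ℝ) (x i) - a)|) := fun x => by
      refine ⟨B, ?_⟩
      rintro _ ⟨g, rfl⟩
      exact abs_inv_mul_sum_le fun i => by rw [abs_units_mul]; exact hB g g.2 _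
    refine Real.iSup_le (fun g => ?_) (add_nonneg (Real.iSup_nonneg fun _ => abs_nonneg _)
      (Real.iSup_nonneg fun _ => abs_nonneg _))
    refine le_trans (le_of_eq_of_le ?_ (abs_sub _ _)) (add_le_add (le_ciSup (hbdd x) g)
      (le_ciSup (hbdd x') g))
    rw [← mul_sub, ← Finset.sum_sub_distrib]
    congr 2
    exact Finset.sum_congr rfl fun i _ => by ring
  have h1 : ∫ x, ghostDev G μ x ∂ν = ∫ z, pairDev G 1 z.1 z.2 ∂(ν.prod ν) :=
    (integral_prod _ (integrable_pairDev_prod hG hosc 1)).symm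
  have h2 : ∫ z, pairDev G 1 z.1 z.2 ∂(ν.prod ν)
      = ∫ z, ((2 : ℝ) ^ n)⁻¹ * ∑ r : Fin n → ℤˣ, pairDev G r z.1 z.2 ∂(ν.prod ν) := by
    rw [integral_const_mul, integral_finsetSum _ fun r _ => integrable_pairDev_prod hG hosc r]
    simp_rw [hν, integral_pairDev_eq]
    simp
  have hU1 : Integrable (fun z : (Fin n → E) × (Fin n → E) => U z.1) (ν.prod ν) := hUi.comp_fst ν
  have hU2 : Integrable (fun z : (Fin n → E) × (Fin n → E) => U z.2) (ν.prod ν) := hUi.comp_snd ν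
  rw [h1, h2]
  calc ∫ z, ((2 : ℝ) ^ n)⁻¹ * ∑ r : Fin n → ℤˣ, pairDev G r z.1 z.2 ∂(ν.prod ν)
      ≤ ∫ z, (U z.1 + U z.2) ∂(ν.prod ν) := by
        refine integral_mono ((integrable_finsetSum _ fun r _ =>
          integrable_pairDev_prod hG hosc r).const_mul _) (hU1.add hU2) fun z => ?_
        refine le_trans ?_ (add_le_add (hU z.1) (hU z.2))
        rw [← mul_add, ← Finset.sum_add_distrib]
        gcongr with r
        exact hpair r z.1 z.2
    _ = 2 * ∫ x, U x ∂ν := by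
        rw [integral_add hU1 hU2, integral_fun_fst (μ := ν) (ν := ν) U,
          integral_fun_snd (μ := ν) (ν := ν) U]
        simp; ring

end Symmetrization

section NetworkConcentration

/-- Sub-Gaussian parameters of possibly dependent variables add up as standard deviations. -/
lemma hasSubgaussianMGF_finset_sum {Ω : Type*} [MeasurableSpace Ω] {P : Measure Ω}
    [IsProbabilityMeasure P] {ι : Type*} (s : Finset ι) {Y : ι → Ω → ℝ} {σ : ι → ℝ≥0}
    (h : ∀ i ∈ s, HasSubgaussianMGF (Y i) (σ i ^ 2) P) :
    HasSubgaussianMGF (fun ω => ∑ i ∈ s, Y i ω) ((∑ i ∈ s, σ i) ^ 2) P := by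
  classical
  induction s using Finset.induction_on with
  | empty => simp
  | insert i s his ih =>
    simp_rw [Finset.sum_insert his]
    have := (h i (Finset.mem_insert_self _ _)).add
      (ih fun j hj => h j (Finset.mem_insert_of_mem hj))
    simpa only [NNReal.sqrt_sq] using this

lemma le_Nmax {K : ℕ} (N : Fin K → ℕ) (k : Fin K) : N k ≤ Nmax N :=
  Finset.le_sup (f := N) (Finset.mem_univ k)

/-- Weighted standard deviations are controlled by the network imbalance penalty. -/
lemma sum_div_sqrt_mul_sqrt_Nmax_le {K : ℕ} {w : Fin K → ℝ} (hw : ∀ k, 0 ≤ w k) {N : Fin K → ℕ}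
    (hN : ∀ k, 0 < N k) :
    (∑ k, w k / √(N k : ℝ)) * √(Nmax N : ℝ) ≤ imbalance w N := by
  rw [Finset.sum_mul]
  refine Finset.sum_le_sum fun k _ => ?_
  have hk : (0 : ℝ) < N k := Nat.cast_pos.2 (hN k)
  have h1 : (1 : ℝ) ≤ (Nmax N : ℝ) / N k := by
    rw [one_le_div hk]
    exact_mod_cast le_Nmax N k
  rw [div_mul_eq_mul_div, mul_div_assoc, ← Real.sqrt_div (Nat.cast_nonneg _)]
  refine mul_le_mul_of_nonneg_left ?_ (hw k)
  rw [Real.sqrt_le_left (by positivity)]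
  nlinarith

/-- Concentration of the network average of the deviations, without independence between agents. -/
lemma measureReal_netGhostDev_ge_le {K : ℕ} {E : Fin K → Type*} [∀ k, MeasurableSpace (E k)]
    {μ : ∀ k, Measure (E k)} [∀ k, IsProbabilityMeasure (μ k)] {G : ∀ k, Set (E k → ℝ)}
    (hG : ∀ k, IsMeasurableClass (G k)) {c : ℝ≥0} (hc : 0 < c)
    (hosc : ∀ k, ∀ g ∈ G k, ∀ x y, |g x - g y| ≤ c) {N : Fin K → ℕ} (hN : ∀ k, 0 < N k)
    {Ω : Type*} [MeasurableSpace Ω] {P : Measure Ω} [IsProbabilityMeasure P]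
    {X : ∀ k, Fin (N k) → Ω → E k} (hXmeas : ∀ k n, Measurable (X k n))
    (hXlaw : ∀ k n, P.map (X k n) = μ k) (hXindep : ∀ k, iIndepFun (X k) P)
    {w : Fin K → ℝ} (hw : ∀ k, 0 < w k) (hK : 0 < K) {m t : ℝ}
    (hm : ∑ k, w k * ∫ x, ghostDev (G k) (μ k) x ∂(Measure.pi fun _ : Fin (N k) => μ k) ≤ m)
    (ht : 0 ≤ t) :
    P.real {ω | m + t ≤ ∑ k, w k * ghostDev (G k) (μ k) fun n => X k n ω}
      ≤ Real.exp (-(2 * (Nmax N : ℝ) * t ^ 2 / (imbalance w N ^ 2 * (c : ℝ) ^ 2))) := by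
  have : NeZero K := ⟨hK.ne'⟩
  set M : Fin K → ℝ := fun k =>
    ∫ x, ghostDev (G k) (μ k) x ∂(Measure.pi fun _ : Fin (N k) => μ k) with hM
  set σ : Fin K → ℝ≥0 := fun k => (w k).toNNReal * (c / (2 * NNReal.sqrt (N k))) with hσ
  have hagent : ∀ k, HasSubgaussianMGF
      (fun ω => w k * (ghostDev (G k) (μ k) (fun n => X k n ω) - M k)) (σ k ^ 2) P := by
    intro k
    have hmap : P.map (fun ω n => X k n ω) = Measure.pi fun _ : Fin (N k) => μ k := by
      rw [(iIndepFun_iff_map_fun_eq_pi_map fun n => (hXmeas k n).aemeasurable).1 (hXindep k)]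
      simp_rw [hXlaw]
    have h1 := hasSubgaussianMGF_pi_of_bounded_differences (μ := μ k) (c := c / N k) (B := c)
      (measurable_ghostDev (n := N k) (μ := μ k) (hG k))
      (fun x => by rw [abs_of_nonneg (ghostDev_nonneg x)]; exact ghostDev_le (hG k) (hosc k) x)
      (ghostDev_update_sub_le (hG k) (hosc k))
    rw [← hmap] at h1
    have h2 := (HasSubgaussianMGF.of_map
      (measurable_pi_iff.2 (hXmeas k)).aemeasurable h1).const_mul (w k)
    rw [hmap] at h2
    have hw2 : NNReal.mk (w k ^ 2) (sq_nonneg (w k)) = (w k).toNNReal ^ 2 :=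
      NNReal.eq (by rw [NNReal.coe_pow, Real.coe_toNNReal _ (hw k).le]; rfl)
    change HasSubgaussianMGF (fun ω => w k * (ghostDev (G k) (μ k) (fun n => X k n ω) - M k))
      (NNReal.mk (w k ^ 2) (sq_nonneg (w k)) * (N k * (c / N k / 2) ^ 2)) P at h2
    rw [hw2] at h2
    suffices hpar : σ k ^ 2 = (w k).toNNReal ^ 2 * (N k * (c / N k / 2) ^ 2) by
      rw [hpar]
      exact h2
    apply NNReal.eq
    have hNk : (0 : ℝ) < N k := Nat.cast_pos.2 (hN k)
    have hsq := Real.sq_sqrt hNk.le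
    have hpos := Real.sqrt_pos.2 hNk
    simp only [hσ, NNReal.coe_pow, NNReal.coe_mul, NNReal.coe_div, Real.coe_toNNReal _ (hw k).le,
      NNReal.coe_natCast, Real.coe_sqrt, NNReal.coe_ofNat]
    rw [mul_pow, div_pow, mul_pow, hsq]
    field_simp
  have hsum := hasSubgaussianMGF_finset_sum Finset.univ fun k _ => hagent k
  have hNmax : (0 : ℝ) < Nmax N := Nat.cast_pos.2 ((hN 0).trans_le (le_Nmax N 0))
  have hS : ((∑ k, σ k : ℝ≥0) : ℝ) = c / 2 * ∑ k, w k / √(N k : ℝ) := by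
    rw [NNReal.coe_sum, Finset.mul_sum]
    refine Finset.sum_congr rfl fun k _ => ?_
    simp only [hσ, NNReal.coe_mul, NNReal.coe_div, Real.coe_toNNReal _ (hw k).le,
      NNReal.coe_natCast, Real.coe_sqrt, NNReal.coe_ofNat]
    ring
  set S : ℝ := ∑ k, w k / √(N k : ℝ) with hSdef
  have hSpos : 0 < S := Finset.sum_pos (fun k _ => div_pos (hw k)
    (Real.sqrt_pos.2 (Nat.cast_pos.2 (hN k)))) Finset.univ_nonempty
  have hα := sum_div_sqrt_mul_sqrt_Nmax_le (fun k => (hw k).le) hN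
  have hαpos : 0 < imbalance w N :=
    (mul_pos hSpos (Real.sqrt_pos.2 hNmax)).trans_le hα
  have hα2 : S ^ 2 * Nmax N ≤ imbalance w N ^ 2 := by
    calc S ^ 2 * Nmax N = (S * √(Nmax N : ℝ)) ^ 2 := by rw [mul_pow, Real.sq_sqrt hNmax.le]
      _ ≤ _ := by gcongr
  have hcpos : (0 : ℝ) < c := hc
  calc P.real {ω | m + t ≤ ∑ k, w k * ghostDev (G k) (μ k) fun n => X k n ω}
      ≤ P.real {ω | t ≤ ∑ k, w k * (ghostDev (G k) (μ k) (fun n => X k n ω) - M k)} := by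
        refine measureReal_mono fun ω hω => ?_
        simp only [Set.mem_ofPred_eq, mul_sub, Finset.sum_sub_distrib] at hω ⊢
        linarith
    _ ≤ Real.exp (-t ^ 2 / (2 * (((∑ k, σ k) ^ 2 : ℝ≥0) : ℝ))) := hsum.measure_ge_le ht
    _ ≤ _ := by
        rw [NNReal.coe_pow, hS, Real.exp_le_exp, neg_div, neg_le_neg_iff,
          div_le_div_iff₀ (by positivity) (by positivity)]
        calc 2 * (Nmax N : ℝ) * t ^ 2 * (2 * (c / 2 * S) ^ 2)
            = t ^ 2 * c ^ 2 * (S ^ 2 * Nmax N) := by ring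
          _ ≤ t ^ 2 * c ^ 2 * imbalance w N ^ 2 := by gcongr
          _ = _ := by ring

end NetworkConcentration

section Training

variable {H : Type*}

lemma iSup_image_real {α γ : Type*} (p : α → γ) (S : Set α) (h : γ → ℝ) :
    ⨆ b : p '' S, h b = ⨆ a : S, h (p a) :=
  (Set.imageFactorization_surjective (f := p) (s := S)).iSup_comp (g := fun b : p '' S => h b) |>.symm

/-- The class `F`, seen as functions of labelled examples. -/
def featureClass (F : Set (H → ℝ)) : Set (H × ℤˣ → ℝ) := (fun f x => f x.1) '' F

variable {F : Set (H → ℝ)} {b : ℝ≥0}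

lemma featureClass_osc_le (hF : ∀ f ∈ F, ∀ h, |f h| ≤ b) :
    ∀ g ∈ featureClass F, ∀ x y, |g x - g y| ≤ (2 * b : ℝ≥0) := by
  rintro _ ⟨f, hf, rfl⟩ x y
  refine (abs_sub _ _).trans ?_
  push_cast
  linarith [hF f hf x.1, hF f hf y.1]

variable {φ : ℝ → ℝ} {L : ℝ≥0}

lemma abs_lossAt_sub_le (hφ : LipschitzWith L φ) (f f' : H → ℝ) (x : H × ℤˣ) :
    |lossAt φ f x - lossAt φ f' x|
      ≤ |L * (((x.2 : ℤ) : ℝ) * f x.1) - L * (((x.2 : ℤ) : ℝ) * f' x.1)| := by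
  rw [← mul_sub, abs_mul, NNReal.abs_eq]
  simpa only [Real.dist_eq, lossAt] using
    hφ.dist_le_mul (((x.2 : ℤ) : ℝ) * f x.1) (((x.2 : ℤ) : ℝ) * f' x.1)

lemma lossClass_osc_le (hφ : LipschitzWith L φ) (hF : ∀ f ∈ F, ∀ h, |f h| ≤ b) :
    ∀ g ∈ lossClass φ F, ∀ x y, |g x - g y| ≤ (L * (2 * b) : ℝ≥0) := by
  rintro _ ⟨f, hf, rfl⟩ x y
  have h1 := hφ.dist_le_mul (((x.2 : ℤ) : ℝ) * f x.1) (((y.2 : ℤ) : ℝ) * f y.1)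
  rw [Real.dist_eq, Real.dist_eq] at h1
  refine h1.trans ?_
  push_cast
  gcongr
  refine (abs_sub _ _).trans ?_
  rw [abs_units_mul, abs_units_mul]
  linarith [hF f hf x.1, hF f hf y.1]

lemma abs_lossAt_sub_zero_le (hφ : LipschitzWith L φ) (f : H → ℝ) (x : H × ℤˣ) :
    |lossAt φ f x - φ 0| ≤ |L * (((x.2 : ℤ) : ℝ) * f x.1)| := by
  simpa [lossAt] using abs_lossAt_sub_le hφ f 0 x

lemma empRademacher_nonneg {n : ℕ} (h : Fin n → H) : 0 ≤ empRademacher F h :=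
  mul_nonneg (by positivity) (Finset.sum_nonneg fun _ _ => Real.iSup_nonneg fun _ => abs_nonneg _)

lemma empRademacher_le (hF : ∀ f ∈ F, ∀ h, |f h| ≤ b) {n : ℕ} (h : Fin n → H) :
    empRademacher F h ≤ b := by
  rw [empRademacher, inv_mul_le_iff₀ (by positivity)]
  refine (Finset.sum_le_sum (g := fun _ => (b : ℝ)) fun r _ => Real.iSup_le (fun f => ?_) b.2).trans
    (by simp)
  exact abs_inv_mul_sum_le fun i => by rw [abs_units_mul]; exact hF f f.2 _

/-- The centred empirical Rademacher complexity of the loss class. -/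
lemma empRademacher_lossClass_le (hφ : LipschitzWith L φ) (hne : F.Nonempty)
    (hF : ∀ f ∈ F, ∀ h, |f h| ≤ b) {n : ℕ} (x : Fin n → H × ℤˣ) :
    ((2 : ℝ) ^ n)⁻¹ * ∑ r : Fin n → ℤˣ,
        ⨆ g : lossClass φ F, |(n : ℝ)⁻¹ * ∑ i, ((r i : ℤ) : ℝ) * ((g : H × ℤˣ → ℝ) (x i) - φ 0)|
      ≤ 2 * L * empRademacher F fun i => (x i).1 := by
  have : Nonempty F := hne.to_subtype
  have hu : ∀ (f : F) i, |L * ((((x i).2 : ℤ) : ℝ) * (f : H → ℝ) (x i).1)| ≤ L * b := fun f i => by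
    rw [abs_mul, NNReal.abs_eq, abs_units_mul]
    gcongr
    exact hF f f.2 _
  have hcon := sum_signs_ciSup_abs_contraction
    (fun (f : F) i => lossAt φ f (x i) - φ 0)
    (fun (f : F) i => L * ((((x i).2 : ℤ) : ℝ) * (f : H → ℝ) (x i).1)) (C := L * b)
    (fun f i => (abs_lossAt_sub_zero_le hφ f (x i)).trans (hu f i)) hu
    (fun f f' i => by
      rw [sub_sub_sub_cancel_right]
      exact abs_lossAt_sub_le hφ f f' (x i))
    (fun f i => abs_lossAt_sub_zero_le hφ f (x i))
  have hn : (0 : ℝ) ≤ (n : ℝ)⁻¹ := by positivity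
  have hleft : ∀ r : Fin n → ℤˣ,
      ⨆ g : lossClass φ F, |(n : ℝ)⁻¹ * ∑ i, ((r i : ℤ) : ℝ) * ((g : H × ℤˣ → ℝ) (x i) - φ 0)|
        = (n : ℝ)⁻¹ * ⨆ f : F, |∑ i, ((r i : ℤ) : ℝ) * (lossAt φ f (x i) - φ 0)| := fun r => by
    rw [Real.mul_iSup_of_nonneg hn]
    simp_rw [abs_mul, abs_of_nonneg hn]
    exact iSup_image_real _ F fun g : H × ℤˣ → ℝ => (n : ℝ)⁻¹ * |∑ i, ((r i : ℤ) : ℝ) * (g (x i) - φ 0)|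
  have hright : ∀ r : Fin n → ℤˣ,
      (n : ℝ)⁻¹ * ⨆ f : F, |∑ i, ((r i : ℤ) : ℝ) * (L * ((((x i).2 : ℤ) : ℝ) * (f : H → ℝ) (x i).1))|
        = L * ⨆ f : F, |(n : ℝ)⁻¹ *
            ∑ i, (((r * fun i => (x i).2) i : ℤˣ) : ℤ) * (f : H → ℝ) (x i).1| := fun r => by
    rw [Real.mul_iSup_of_nonneg hn, Real.mul_iSup_of_nonneg L.coe_nonneg]
    refine iSup_congr fun f => ?_
    have : ∑ i, ((r i : ℤ) : ℝ) * (L * ((((x i).2 : ℤ) : ℝ) * (f : H → ℝ) (x i).1))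
        = L * ∑ i, (((r * fun i => (x i).2) i : ℤˣ) : ℤ) * (f : H → ℝ) (x i).1 := by
      rw [Finset.mul_sum]
      refine Finset.sum_congr rfl fun i _ => ?_
      simp only [Pi.mul_apply, Units.val_mul, Int.cast_mul]
      ring
    rw [this, abs_mul, abs_mul, NNReal.abs_eq, abs_of_nonneg hn]
    ring
  have hperm : ∑ r : Fin n → ℤˣ, ⨆ f : F, |(n : ℝ)⁻¹ *
            ∑ i, (((r * fun i => (x i).2) i : ℤˣ) : ℤ) * (f : H → ℝ) (x i).1|
      = ∑ r : Fin n → ℤˣ, ⨆ f : F, |(n : ℝ)⁻¹ * ∑ i, ((r i : ℤ) : ℝ) * (f : H → ℝ) (x i).1| :=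
    Equiv.sum_comp (Equiv.mulRight fun i => (x i).2) fun r : Fin n → ℤˣ =>
      ⨆ f : F, |(n : ℝ)⁻¹ * ∑ i, ((r i : ℤ) : ℝ) * (f : H → ℝ) (x i).1|
  simp_rw [hleft]
  rw [empRademacher, ← hperm, ← Finset.mul_sum]
  have hcon' := mul_le_mul_of_nonneg_left hcon hn
  rw [mul_left_comm, Finset.mul_sum (s := Finset.univ) (a := (n : ℝ)⁻¹) (f := fun r : Fin n → ℤˣ =>
    ⨆ f : F, |∑ i, ((r i : ℤ) : ℝ) * (L * ((((x i).2 : ℤ) : ℝ) * (f : H → ℝ) (x i).1))|)] at hcon'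
  simp_rw [hright] at hcon'
  rw [← Finset.mul_sum] at hcon'
  refine (mul_le_mul_of_nonneg_left hcon' (by positivity)).trans (le_of_eq ?_)
  ring

variable [MeasurableSpace H]

instance isProbabilityMeasure_trainLaw (ℓ : ℤˣ → Measure H) [∀ γ, IsProbabilityMeasure (ℓ γ)] :
    IsProbabilityMeasure (trainLaw ℓ) := by
  constructor
  simp [trainLaw, ENNReal.inv_two_add_inv_two]

lemma integral_trainLaw (ℓ : ℤˣ → Measure H) [∀ γ, IsProbabilityMeasure (ℓ γ)]
    {g : H × ℤˣ → ℝ} (hg : Measurable g) {B : ℝ} (hB : ∀ x, |g x| ≤ B) :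
    ∫ x, g x ∂(trainLaw ℓ)
      = 2⁻¹ * ∫ h, g (h, 1) ∂(ℓ 1) + 2⁻¹ * ∫ h, g (h, -1) ∂(ℓ (-1)) := by
  have hI : ∀ (ν : Measure (H × ℤˣ)) [IsProbabilityMeasure ν],
      Integrable g ((2⁻¹ : ℝ≥0∞) • ν) := fun ν _ =>
    (Integrable.of_bound hg.aestronglyMeasurable B (ae_of_all _ hB)).smul_measure (by simp)
  have hp : ∀ γ γ' : ℤˣ, ∫ x, g x ∂((ℓ γ).prod (Measure.dirac γ')) = ∫ h, g (h, γ') ∂(ℓ γ) :=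
    fun γ γ' => by
      rw [Measure.prod_dirac, integral_map (by fun_prop) hg.aestronglyMeasurable]
  rw [trainLaw, integral_add_measure (hI _) (hI _), integral_smul_measure, integral_smul_measure,
    hp, hp]
  simp

lemma isMeasurableClass_featureClass (hF : IsMeasurableClass F) :
    IsMeasurableClass (featureClass F) where
  measurable := by
    rintro _ ⟨f, hf, rfl⟩
    exact (hF.measurable f hf).comp measurable_fst
  measurable_iSup n e := by
    have h1 : Measurable fun (x : Fin n → H × ℤˣ) i => (x i).1 := by fun_prop
    convert (hF.measurable_iSup n e).comp h1 using 1
    funext x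
    exact iSup_image_real _ F fun g : H × ℤˣ → ℝ => |∑ i, e i * g (x i)|

lemma measurable_empRademacher (hF : IsMeasurableClass F) {n : ℕ} :
    Measurable fun h : Fin n → H => empRademacher F h := by
  refine (Finset.measurable_sum _ fun r _ => ?_).const_mul _
  convert hF.measurable_iSup n fun i => (n : ℝ)⁻¹ * ((r i : ℤ) : ℝ) using 1
  funext h
  refine iSup_congr fun f => ?_
  simp_rw [Finset.mul_sum, mul_assoc]

variable {ℓ : ℤˣ → Measure H} [∀ γ, IsProbabilityMeasure (ℓ γ)]

lemma integrable_empRademacher (hFm : IsMeasurableClass F) (hF : ∀ f ∈ F, ∀ h, |f h| ≤ b) {n : ℕ} :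
    Integrable (fun x : Fin n → H × ℤˣ => empRademacher F fun i => (x i).1)
      (Measure.pi fun _ => trainLaw ℓ) := by
  have h1 : Measurable fun (x : Fin n → H × ℤˣ) i => (x i).1 := by fun_prop
  refine Integrable.of_bound ((measurable_empRademacher hFm).comp h1).aestronglyMeasurable b
    (ae_of_all _ fun x => ?_)
  rw [Real.norm_eq_abs, abs_of_nonneg (empRademacher_nonneg _)]
  exact empRademacher_le hF _

lemma rademacher_nonneg {ℓ : ℤˣ → Measure H} {n : ℕ} : 0 ≤ rademacher ℓ F n :=
  integral_nonneg fun _ => empRademacher_nonneg _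

lemma integral_ghostDev_featureClass_le (hFm : IsMeasurableClass F)
    (hF : ∀ f ∈ F, ∀ h, |f h| ≤ b) (n : ℕ) :
    ∫ x, ghostDev (featureClass F) (trainLaw ℓ) x ∂(Measure.pi fun _ : Fin n => trainLaw ℓ)
      ≤ 2 * rademacher ℓ F n := by
  refine integral_ghostDev_le (isMeasurableClass_featureClass hFm) (featureClass_osc_le hF)
    (a := 0) (B := b) ?_ (integrable_empRademacher hFm hF) fun x => le_of_eq ?_
  · rintro _ ⟨f, hf, rfl⟩ x
    simpa using hF f hf x.1
  · simp only [sub_zero]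
    rw [empRademacher]
    congr 1
    exact Finset.sum_congr rfl fun r _ =>
      iSup_image_real _ F fun g : H × ℤˣ → ℝ => |(n : ℝ)⁻¹ * ∑ i, ((r i : ℤ) : ℝ) * g (x i)|

lemma integral_ghostDev_lossClass_le (hφ : LipschitzWith L φ) (hne : F.Nonempty)
    (hFm : IsMeasurableClass F) (hFl : IsMeasurableClass (lossClass φ F))
    (hF : ∀ f ∈ F, ∀ h, |f h| ≤ b) (n : ℕ) :
    ∫ x, ghostDev (lossClass φ F) (trainLaw ℓ) x ∂(Measure.pi fun _ : Fin n => trainLaw ℓ)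
      ≤ 4 * L * rademacher ℓ F n := by
  refine (integral_ghostDev_le hFl (lossClass_osc_le hφ hF) (a := φ 0) (B := L * b) ?_
    ((integrable_empRademacher hFm hF).const_mul (2 * (L : ℝ)))
    (empRademacher_lossClass_le hφ hne hF)).trans (le_of_eq ?_)
  · rintro _ ⟨f, hf, rfl⟩ x
    refine (abs_lossAt_sub_zero_le hφ f x).trans ?_
    rw [abs_mul, NNReal.abs_eq, abs_units_mul, NNReal.coe_mul]
    gcongr
    exact hF f hf _
  · rw [integral_const_mul, rademacher]
    ring

/-- Jensen's inequality for the risk. -/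
lemma jensen_risk_ge (hconv : ConvexOn ℝ Set.univ φ) (hφ : LipschitzWith L φ)
    (hFm : IsMeasurableClass F) (hFl : IsMeasurableClass (lossClass φ F))
    (hF : ∀ f ∈ F, ∀ h, |f h| ≤ b) {f : H → ℝ} (hf : f ∈ F) :
    2⁻¹ * φ (∫ h, f h ∂(ℓ 1)) + 2⁻¹ * φ (-∫ h, f h ∂(ℓ (-1))) ≤ risk φ ℓ f := by
  have hfm := hFm.measurable f hf
  have hbound : ∀ x, |lossAt φ f x| ≤ |φ 0| + L * b := fun x => by
    have h1 := abs_lossAt_sub_zero_le hφ f x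
    rw [abs_mul, NNReal.abs_eq, abs_units_mul] at h1
    have h2 := abs_sub_abs_le_abs_sub (lossAt φ f x) (φ 0)
    have h3 := mul_le_mul_of_nonneg_left (hF f hf x.1) L.coe_nonneg
    linarith
  have hlm : Measurable (lossAt φ f) := hFl.measurable _ (Set.mem_image_of_mem _ hf)
  have hfi : ∀ γ, Integrable f (ℓ γ) := fun γ =>
    Integrable.of_bound hfm.aestronglyMeasurable b (ae_of_all _ (hF f hf))
  have hli : ∀ γ, Integrable (fun h => lossAt φ f (h, γ)) (ℓ γ) := fun γ =>
    Integrable.of_bound (hlm.comp measurable_prodMk_right).aestronglyMeasurable (|φ 0| + L * b)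
      (ae_of_all _ fun h => hbound (h, γ))
  have hJ : ∀ γ : ℤˣ, φ (((γ : ℤ) : ℝ) * ∫ h, f h ∂(ℓ γ)) ≤ ∫ h, lossAt φ f (h, γ) ∂(ℓ γ) :=
    fun γ => by
      rw [← integral_const_mul]
      exact hconv.map_integral_le hφ.continuous.continuousOn isClosed_univ (by simp)
        ((hfi γ).const_mul _) (hli γ)
  rw [risk, integral_trainLaw ℓ hlm hbound]
  have h1 := hJ 1
  have h2 := hJ (-1)
  simp only [Units.val_one, Int.cast_one, one_mul, Units.val_neg, Int.cast_neg, neg_mul] at h1 h2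
  linarith

/-- An empirical risk minimizer is optimal up to twice the deviation of the empirical risks. -/
lemma risk_le_of_isERM (hφ : LipschitzWith L φ) (hFl : IsMeasurableClass (lossClass φ F))
    (hF : ∀ f ∈ F, ∀ h, |f h| ≤ b) {n : ℕ} (hn : 0 < n) {x : Fin n → H × ℤˣ} {f : H → ℝ}
    (hf : IsERM φ F x f) :
    risk φ ℓ f ≤ targetRisk φ ℓ F + 2 * ghostDev (lossClass φ F) (trainLaw ℓ) x := by
  have : Nonempty F := ⟨⟨f, hf.1⟩⟩
  have hdev : ∀ f ∈ F, |empRisk φ x f - risk φ ℓ f|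
      ≤ ghostDev (lossClass φ F) (trainLaw ℓ) x := fun f hf =>
    abs_mean_sub_integral_le_ghostDev hn hFl (lossClass_osc_le hφ hF) (Set.mem_image_of_mem _ hf) x
  rw [← sub_le_iff_le_add]
  refine le_ciInf fun f' => ?_
  have h1 := abs_le.1 (hdev f hf.1)
  have h2 := abs_le.1 (hdev f' f'.2)
  linarith [hf.2 f' f'.2]

lemma abs_empMean_sub_le (hFm : IsMeasurableClass F) (hF : ∀ f ∈ F, ∀ h, |f h| ≤ b) {n : ℕ}
    (hn : 0 < n) (x : Fin n → H × ℤˣ) {f : H → ℝ} (hf : f ∈ F) :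
    |empMean x f - 2⁻¹ * (∫ h, f h ∂(ℓ 1) + ∫ h, f h ∂(ℓ (-1)))|
      ≤ ghostDev (featureClass F) (trainLaw ℓ) x := by
  have h := abs_mean_sub_integral_le_ghostDev (μ := trainLaw ℓ) hn
    (isMeasurableClass_featureClass hFm) (featureClass_osc_le hF)
    (Set.mem_image_of_mem (fun (f : H → ℝ) (x : H × ℤˣ) => f x.1) hf) x
  rw [integral_trainLaw ℓ (g := fun x => f x.1) ((hFm.measurable f hf).comp measurable_fst)
    fun x => hF f hf x.1, ← mul_add] at h
  exact h

end Training

lemma IsLoss.lipschitz_pos {φ : ℝ → ℝ} {L : ℝ≥0} (hφ : IsLoss φ L) : 0 < L := by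
  rcases eq_or_ne L 0 with rfl | h
  · have hconst : φ = fun _ => φ 0 := by
      funext x
      have := hφ.lipschitz.dist_le_mul x 0
      simpa [sub_eq_zero] using this
    have := hφ.deriv_neg
    rw [hconst] at this
    simp at this
  · exact pos_iff_ne_zero.2 h

lemma gFun_eq_iff {φ : ℝ → ℝ} {L : ℝ≥0} (hL : 0 < L) {R d δ : ℝ} :
    gFun φ L R d = δ ↔ φ d = R + 2 * L * (d - δ) := by
  have hL' : (0 : ℝ) < L := hL
  rw [gFun, sub_eq_iff_eq_add, ← sub_eq_iff_eq_add', eq_comm, div_eq_iff (by positivity)]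
  constructor <;> intro h <;> linarith

/-- The margin equation `g(d) = δ` has exactly one solution. -/
lemma existsUnique_gFun_eq {φ : ℝ → ℝ} {L : ℝ≥0} (hφ : IsLoss φ L) (R δ : ℝ) :
    ∃! d : ℝ, gFun φ L R d = δ := by
  have hL : (0 : ℝ) < 2 * L := by have : (0 : ℝ) < L := hφ.lipschitz_pos; positivity
  have hmono : StrictMono (gFun φ L R) := fun x y hxy => by
    have : (φ y - R) / (2 * L) ≤ (φ x - R) / (2 * L) := by
      gcongr
      exact hφ.antitone hxy.le
    rw [gFun, gFun]
    linarith
  have hcont : Continuous (gFun φ L R) := by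
    have := hφ.lipschitz.continuous
    unfold gFun
    fun_prop
  have hbot : Filter.Tendsto (gFun φ L R) Filter.atBot Filter.atBot := by
    refine Filter.tendsto_atBot_mono (f := fun x => x + R / (2 * L)) (fun x => ?_)
      (Filter.tendsto_atBot_add_const_right _ _ Filter.tendsto_id)
    have : 0 ≤ φ x / (2 * L) := div_nonneg (hφ.nonneg x) hL.le
    rw [gFun, sub_div]
    linarith
  have htop : Filter.Tendsto (gFun φ L R) Filter.atTop Filter.atTop := by
    refine Filter.tendsto_atTop_mono' _ (f₁ := fun x => x + -((φ 0 - R) / (2 * L))) ?_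
      (Filter.tendsto_atTop_add_const_right _ _ Filter.tendsto_id)
    filter_upwards [Filter.eventually_ge_atTop 0] with x hx
    have : (φ x - R) / (2 * L) ≤ (φ 0 - R) / (2 * L) := by
      gcongr
      exact hφ.antitone hx
    rw [gFun]
    linarith
  obtain ⟨d, hd⟩ := hcont.surjective htop hbot δ
  exact ⟨d, hd, fun y hy => hmono.injective (hy.trans hd.symm)⟩

/-- If the empirical means and risks are close enough to their expectations, the network decides
with margin `δ`. -/
lemma margin_of_deviations_lt {K : ℕ} {w : Fin K → ℝ} (hw : ∀ k, 0 < w k) (hw1 : ∑ k, w k = 1)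
    {φ : ℝ → ℝ} {L : ℝ≥0} (hφ : IsLoss φ L) {mp mm em rk tk g₁ g₂ : Fin K → ℝ}
    (hJ : ∀ k, 2⁻¹ * φ (mp k) + 2⁻¹ * φ (-mm k) ≤ rk k) (hR : ∀ k, rk k ≤ tk k + 2 * g₂ k)
    (hM : ∀ k, |em k - 2⁻¹ * (mp k + mm k)| ≤ g₁ k) {d δ : ℝ}
    (hd : gFun φ L (∑ k, w k * tk k) d = δ) (h₁ : ∑ k, w k * g₁ k < d - δ)
    (h₂ : ∑ k, w k * g₂ k < L * (d - δ)) :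
    ∑ k, w k * mp k > ∑ k, w k * em k + δ ∧ ∑ k, w k * mm k < ∑ k, w k * em k - δ := by
  have hjensen : ∀ v : Fin K → ℝ, φ (∑ k, w k * v k) ≤ ∑ k, w k * φ (v k) := fun v =>
    hφ.convex.map_sum_le (fun k _ => (hw k).le) hw1 fun _ _ => Set.mem_univ _
  have hmid : φ (2⁻¹ * ∑ k, w k * mp k + 2⁻¹ * ∑ k, w k * -mm k)
      ≤ 2⁻¹ * φ (∑ k, w k * mp k) + 2⁻¹ * φ (∑ k, w k * -mm k) :=
    hφ.convex.2 (Set.mem_univ _) (Set.mem_univ _) (by norm_num) (by norm_num) (by norm_num)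
  have hrisk : ∑ k, w k * (2⁻¹ * φ (mp k) + 2⁻¹ * φ (-mm k)) ≤ ∑ k, w k * (tk k + 2 * g₂ k) :=
    Finset.sum_le_sum fun k _ => mul_le_mul_of_nonneg_left ((hJ k).trans (hR k)) (hw k).le
  have hmean : |∑ k, w k * (em k - 2⁻¹ * (mp k + mm k))| ≤ ∑ k, w k * g₁ k := by
    refine (Finset.abs_sum_le_sum_abs _ _).trans (Finset.sum_le_sum fun k _ => ?_)
    rw [abs_mul, abs_of_pos (hw k)]
    exact mul_le_mul_of_nonneg_left (hM k) (hw k).le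
  have e1 : ∑ k, w k * (2⁻¹ * φ (mp k) + 2⁻¹ * φ (-mm k))
      = 2⁻¹ * ∑ k, w k * φ (mp k) + 2⁻¹ * ∑ k, w k * φ (-mm k) := by
    rw [Finset.mul_sum, Finset.mul_sum, ← Finset.sum_add_distrib]
    exact Finset.sum_congr rfl fun k _ => by ring
  have e2 : ∑ k, w k * (tk k + 2 * g₂ k) = ∑ k, w k * tk k + 2 * ∑ k, w k * g₂ k := by
    rw [Finset.mul_sum, ← Finset.sum_add_distrib]
    exact Finset.sum_congr rfl fun k _ => by ring
  have e3 : ∑ k, w k * (em k - 2⁻¹ * (mp k + mm k))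
      = ∑ k, w k * em k - 2⁻¹ * (∑ k, w k * mp k + ∑ k, w k * mm k) := by
    rw [← Finset.sum_add_distrib, Finset.mul_sum, ← Finset.sum_sub_distrib]
    exact Finset.sum_congr rfl fun k _ => by ring
  have e4 : ∑ k, w k * -mm k = -∑ k, w k * mm k := by simp
  have hφd := (gFun_eq_iff hφ.lipschitz_pos).1 hd
  have hlt : φ (2⁻¹ * ∑ k, w k * mp k + 2⁻¹ * ∑ k, w k * -mm k) < φ d := by
    have j1 := hjensen mp
    have j2 := hjensen fun k => -mm k
    rw [hφd]
    linarith
  have hD : d < 2⁻¹ * ∑ k, w k * mp k + 2⁻¹ * ∑ k, w k * -mm k :=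
    lt_of_not_ge fun h => (hφ.antitone h).not_gt hlt
  rw [e3] at hmean
  rw [e4] at hD
  have := abs_le.1 hmean
  constructor <;> linarith

end SML

theorem lemma2 {K : ℕ} {H : Fin K → Type*} [∀ k, MeasurableSpace (H k)]
    -- network and Perron eigenvector
    (A : Matrix (Fin K) (Fin K) ℝ) (hA : SML.IsCombinationMatrix A)
    (w : Fin K → ℝ) (hw : SML.IsPerronVector A w)
    -- loss function
    (φ : ℝ → ℝ) (L : ℝ≥0) (hφ : SML.IsLoss φ L)
    -- likelihood models
    (ℓ : ∀ k, ℤˣ → Measure (H k)) [∀ k γ, IsProbabilityMeasure (ℓ k γ)]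
    -- function classes, bounded by `β`
    (F : ∀ k, Set (H k → ℝ)) (β : ℝ) (hβ : 0 < β)
    (hF : ∀ k, ∀ f ∈ F k, ∀ h, |f h| ≤ β)
    (hFmeas : ∀ k, SML.IsMeasurableClass (F k))
    (hFloss : ∀ k, SML.IsMeasurableClass (SML.lossClass φ (F k)))
    -- training sets: `N k` i.i.d. labelled examples at agent `k`
    (N : Fin K → ℕ) (hN : ∀ k, 0 < N k)
    {Ω : Type*} [MeasurableSpace Ω] (P : Measure Ω) [IsProbabilityMeasure P]
    (X : ∀ k, Fin (N k) → Ω → H k × ℤˣ)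
    (hXmeas : ∀ k n, Measurable (X k n))
    (hXlaw : ∀ k n, P.map (X k n) = SML.trainLaw (ℓ k))
    (hXindep : ∀ k, iIndepFun (X k) P)
    -- trained functions
    (ftilde : Ω → ∀ k, H k → ℝ)
    (hftilde : ∀ᵐ ω ∂P, ∀ k, SML.IsERM φ (F k) (fun n => X k n ω) (ftilde ω k))
    -- the target risk is below the risk of the uninformative classifier
    (hR : SML.netTargetRisk w φ ℓ F < φ 0)
    -- margin
    (δ : ℝ) (hδ : 0 ≤ δ) (hδmax : δ < SML.deltaMax φ L (SML.netTargetRisk w φ ℓ F)) :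
    (∃! d : ℝ, SML.gFun φ L (SML.netTargetRisk w φ ℓ F) d = δ) ∧
    ∀ d : ℝ, SML.gFun φ L (SML.netTargetRisk w φ ℓ F) d = δ →
      SML.netRademacher w ℓ F N < (d - δ) / 4 →
      1 - 2 * Real.exp (-(8 * (SML.Nmax N : ℝ) / (SML.imbalance w N ^ 2 * β ^ 2)
          * ((d - δ) / 4 - SML.netRademacher w ℓ F N) ^ 2))
        ≤ P.real {ω |
            SML.netCondMean w ℓ 1 (ftilde ω)
              > SML.netEmpMean w (fun k n => X k n ω) (ftilde ω) + δ ∧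
            SML.netCondMean w ℓ (-1) (ftilde ω)
              < SML.netEmpMean w (fun k n => X k n ω) (ftilde ω) - δ} := by

  refine ⟨SML.existsUnique_gFun_eq hφ _ δ, fun d hd hρ => ?_⟩
  lift β to ℝ≥0 using hβ.le
  have hβ' : 0 < β := hβ
  have hL := hφ.lipschitz_pos
  have hL' : (0 : ℝ) < L := hL
  have hK : 0 < K := Nat.pos_of_ne_zero fun h => by
    subst h
    simpa using hw.sum_eq_one
  have hne : ∀ k, (F k).Nonempty := by
    obtain ⟨ω, hω⟩ := hftilde.exists
    exact fun k => ⟨_, (hω k).1⟩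
  set ρ := SML.netRademacher w ℓ F N with hρ_def
  have hρ0 : 0 ≤ ρ :=
    Finset.sum_nonneg fun k _ => mul_nonneg (hw.pos k).le SML.rademacher_nonneg
  set e := (d - δ) / 4 - ρ with he
  have he0 : 0 ≤ e := by linarith
  set B₁ := {ω | 4 * ρ + 4 * e ≤ ∑ k, w k * SML.ghostDev (SML.featureClass (F k))
    (SML.trainLaw (ℓ k)) fun n => X k n ω}
  set B₂ := {ω | 4 * L * ρ + 4 * L * e ≤ ∑ k, w k * SML.ghostDev (SML.lossClass φ (F k))
    (SML.trainLaw (ℓ k)) fun n => X k n ω}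
  have hB₁ : P.real B₁ ≤ Real.exp (-(8 * (SML.Nmax N : ℝ)
      / (SML.imbalance w N ^ 2 * (β : ℝ) ^ 2) * e ^ 2)) := by
    refine (SML.measureReal_netGhostDev_ge_le
      (fun k => SML.isMeasurableClass_featureClass (hFmeas k)) (c := 2 * β) (by positivity)
      (fun k => SML.featureClass_osc_le (hF k)) hN hXmeas hXlaw hXindep hw.pos hK
      (m := 4 * ρ) ?_ (by positivity)).trans (le_of_eq ?_)
    · rw [hρ_def, SML.netRademacher, Finset.mul_sum]
      refine Finset.sum_le_sum fun k _ => ?_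
      rw [mul_left_comm]
      refine mul_le_mul_of_nonneg_left ((SML.integral_ghostDev_featureClass_le (hFmeas k) (hF k)
        (N k)).trans ?_) (hw.pos k).le
      linarith [SML.rademacher_nonneg (ℓ := ℓ k) (F := F k) (n := N k)]
    · push_cast
      congr 2
      ring
  have hB₂ : P.real B₂ ≤ Real.exp (-(8 * (SML.Nmax N : ℝ)
      / (SML.imbalance w N ^ 2 * (β : ℝ) ^ 2) * e ^ 2)) := by
    refine (SML.measureReal_netGhostDev_ge_le hFloss (c := L * (2 * β)) (by positivity)
      (fun k => SML.lossClass_osc_le hφ.lipschitz (hF k)) hN hXmeas hXlaw hXindep hw.pos hK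
      (m := 4 * L * ρ) ?_ (by positivity)).trans (le_of_eq ?_)
    · rw [hρ_def, SML.netRademacher, Finset.mul_sum]
      refine Finset.sum_le_sum fun k _ => ?_
      rw [mul_left_comm]
      exact mul_le_mul_of_nonneg_left (SML.integral_ghostDev_lossClass_le hφ.lipschitz (hne k)
        (hFmeas k) (hFloss k) (hF k) (N k)) (hw.pos k).le
    · push_cast
      congr 2
      rw [show 2 * (SML.Nmax N : ℝ) * (4 * L * e) ^ 2
          = (4 * (L : ℝ) ^ 2) * (8 * (SML.Nmax N : ℝ) * e ^ 2) by ring,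
        show SML.imbalance w N ^ 2 * ((L : ℝ) * (2 * β)) ^ 2
          = (4 * (L : ℝ) ^ 2) * (SML.imbalance w N ^ 2 * (β : ℝ) ^ 2) by ring,
        mul_div_mul_left _ _ (by positivity)]
      ring
  set T := {ω | ∀ k, SML.IsERM φ (F k) (fun n => X k n ω) (ftilde ω k)}
  have hT : P.real Tᶜ = 0 := by
    rw [measureReal_eq_zero_iff]
    exact hftilde
  have hcover : ∀ S : Set Ω, T \ (B₁ ∪ B₂) ⊆ S → 1 ≤ P.real S + P.real B₁ + P.real B₂ := by
    intro S hS
    have h1 : Set.univ ⊆ S ∪ B₁ ∪ B₂ ∪ Tᶜ := fun ω _ => by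
      by_cases hωS : ω ∈ S
      · simp [hωS]
      · have := fun h => hωS (hS h)
        simp only [Set.mem_sdiff, Set.mem_union, Set.mem_compl_iff] at this ⊢
        tauto
    have h2 := measureReal_mono (μ := P) h1
    rw [probReal_univ] at h2
    linarith [measureReal_union_le (μ := P) (S ∪ B₁ ∪ B₂) Tᶜ,
      measureReal_union_le (μ := P) (S ∪ B₁) B₂, measureReal_union_le (μ := P) S B₁]
  refine (?_ : _ ≤ _).trans (sub_le_iff_le_add.2 ((hcover _ ?_).trans (add_assoc _ _ _).le))
  · linarith
  rintro ω ⟨hω, hωB⟩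
  have h1 : ω ∉ B₁ := fun h => hωB (Or.inl h)
  have h2 : ω ∉ B₂ := fun h => hωB (Or.inr h)
  refine SML.margin_of_deviations_lt hw.pos hw.sum_eq_one hφ
    (fun k => SML.jensen_risk_ge hφ.convex hφ.lipschitz (hFmeas k) (hFloss k) (hF k) (hω k).1)
    (fun k => SML.risk_le_of_isERM hφ.lipschitz (hFloss k) (hF k) (hN k) (hω k))
    (fun k => SML.abs_empMean_sub_le (hFmeas k) (hF k) (hN k) _ (hω k).1) hd
    ((not_le.1 h1).trans_eq ?_) ((not_le.1 h2).trans_eq ?_)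
  · rw [he]; ring
  · rw [he]; ring
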